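/- Let $n\ge 1$ and let $\Omega\subset\mathbb{R}^n$ be nonempty, open and bounded. Let $\{(\lambda_k,\varphi_k)\}_{k\in\mathbb{N}}$ be eigenpairs of the Dirichlet Laplacian on $\Omega$, that is, $\lambda_k>0$, $\{\varphi_k\}_{k\in\mathbb{N}}$ is an orthonormal basis of the real space $L^2(\Omega)$, and for every $k$ one has $\varphi_k\in H_0^1(\Omega)$ and $\int_\Omega\nabla\varphi_k\cdot\nabla v\,dx=\lambda_k\int_\Omega\varphi_k v\,dx$ for all $v\in H_0^1(\Omega)$. For $f\in L^2(\Omega)$ put $f_k=\int_\Omega f\varphi_k\,dx$ and consider the control-to-state map of the equation $(-\Delta)^s u=f$, $$\mathcal{S}:(0,1)\to L^2(\Omega),\qquad \mathcal{S}(s)=\sum_{k\in\mathbb{N}}\lambda_k^{-s}f_k\varphi_k .$$ There is a constant $C$, depending only on $\Omega$, such that for every choice of these eigenpairs and every $f\in L^2(\Omega)$ the following holds. 1. For every $s\in(0,1)$ the series defining $\mathcal{S}(s)$ converges in $L^2(\Omega)$ and $\|\mathcal{S}(s)\|_{L^2(\Omega)}\le C\|f\|_{L^2(\Omega)}$. 2.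 $\mathcal{S}$ is three times Fréchet differentiable on $(0,1)$, and for all $s\in(0,1)$ and $h_1,h_2\in\mathbb{R}$, $$D_s\mathcal{S}(s)[h_1]=h_1D_su(s),\qquad D_s^2\mathcal{S}(s)[h_1,h_2]=h_1h_2D_s^2u(s),$$ where $$D_su(s)=-\sum_{k\in\mathbb{N}}\lambda_k^{-s}\ln(\lambda_k)f_k\varphi_k,\qquad D_s^2u(s)=\sum_{k\in\mathbb{N}}\lambda_k^{-s}\ln^2(\lambda_k)f_k\varphi_k,$$ both series converging in $L^2(\Omega)$. 3. For $m=1,2,3$ and every $s\in(0,1)$, the operator norm of the $m$-th Fréchet derivative (an $m$-linear map $\mathbb{R}^m\to L^2(\Omega)$) satisfies $\|D_s^m\mathcal{S}(s)\|\le C\|f\|_{L^2(\Omega)}\,s^{-m}$. -/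

import Mathlib

open MeasureTheory Filter Topology
open scoped ENNReal ContDiff

noncomputable section

namespace FracIdent

/-- The real Lebesgue space `L²(Ω)` of an open subset of Euclidean space. -/
abbrev L2 {n : ℕ} (Ω : Set (EuclideanSpace ℝ (Fin n))) : Type :=
  Lp ℝ 2 (volume.restrict Ω)

/-- Square integrable vector fields on `Ω`, i.e. `L²(Ω; ℝⁿ)`. -/
abbrev L2Field {n : ℕ} (Ω : Set (EuclideanSpace ℝ (Fin n))) : Type :=
  Lp (EuclideanSpace ℝ (Fin n)) 2 (volume.restrict Ω)

/-- Test functions: `ψ ∈ C_c^∞(Ω)`. -/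
structure IsTestFunction {n : ℕ} (Ω : Set (EuclideanSpace ℝ (Fin n)))
    (ψ : EuclideanSpace ℝ (Fin n) → ℝ) : Prop where
  smooth : ContDiff ℝ ∞ ψ
  compact : HasCompactSupport ψ
  support_subset : tsupport ψ ⊆ Ω

/-- `G` is the weak gradient of `u` in `Ω`: `∫_Ω u ∇ψ = - ∫_Ω ψ G` for all `ψ ∈ C_c^∞(Ω)`. -/
def HasWeakGradient {n : ℕ} (Ω : Set (EuclideanSpace ℝ (Fin n)))
    (u : L2 Ω) (G : L2Field Ω) : Prop :=
  ∀ ψ : EuclideanSpace ℝ (Fin n) → ℝ, IsTestFunction Ω ψ →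
    ∫ x in Ω, u x • gradient ψ x = - ∫ x in Ω, ψ x • G x

/-- `u ∈ H₀¹(Ω)` with weak gradient `∇u = G`: the pair `(u, ∇u)` is a limit, in the norm of
`H¹(Ω)`, of a sequence from `C_c^∞(Ω)`. -/
structure IsH10 {n : ℕ} (Ω : Set (EuclideanSpace ℝ (Fin n)))
    (u : L2 Ω) (G : L2Field Ω) : Prop where
  weakGradient : HasWeakGradient Ω u G
  approx : ∃ ψ : ℕ → EuclideanSpace ℝ (Fin n) → ℝ,
    (∀ j, IsTestFunction Ω (ψ j)) ∧
    Tendsto (fun j => eLpNorm (fun x => ψ j x - u x) 2 (volume.restrict Ω)) atTop (𝓝 0) ∧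
    Tendsto (fun j => eLpNorm (fun x => gradient (ψ j) x - G x) 2 (volume.restrict Ω))
      atTop (𝓝 0)

/-- `u` solves `-Δ u = μ u` in `Ω`, `u = 0` on `∂Ω`, in the usual weak sense: `u ∈ H₀¹(Ω)` and
`∫_Ω ∇u · ∇v = μ ∫_Ω u v` for all `v ∈ H₀¹(Ω)` (the inner products below are those of
`L²(Ω; ℝⁿ)` and `L²(Ω)`). -/
def SolvesDirichletEigenproblem {n : ℕ} (Ω : Set (EuclideanSpace ℝ (Fin n)))
    (μ : ℝ) (u : L2 Ω) : Prop :=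
  ∃ G : L2Field Ω, IsH10 Ω u G ∧
    ∀ (v : L2 Ω) (H : L2Field Ω), IsH10 Ω v H → inner ℝ G H = μ * inner ℝ u v

/-- The eigenpairs `(λ_k, φ_k)` of the Dirichlet Laplacian on `Ω`, with `λ_k > 0` and
`(φ_k)` an orthonormal basis of `L²(Ω)`. -/
structure IsDirichletEigensystem {n : ℕ} (Ω : Set (EuclideanSpace ℝ (Fin n)))
    (lam : ℕ → ℝ) (φ : HilbertBasis ℕ ℝ (L2 Ω)) : Prop where
  pos : ∀ k, 0 < lam k
  eigen : ∀ k, SolvesDirichletEigenproblem Ω (lam k) (φ k)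

/-- The coefficient `f_k = (f, φ_k)_{L²(Ω)}`. -/
def coeff {n : ℕ} {Ω : Set (EuclideanSpace ℝ (Fin n))}
    (φ : HilbertBasis ℕ ℝ (L2 Ω)) (f : L2 Ω) (k : ℕ) : ℝ :=
  inner ℝ f (φ k)

/-- The `k`-th term `λ_k^{-s} f_k φ_k` of the state. -/
def stateTerm {n : ℕ} {Ω : Set (EuclideanSpace ℝ (Fin n))} (lam : ℕ → ℝ)
    (φ : HilbertBasis ℕ ℝ (L2 Ω)) (f : L2 Ω) (s : ℝ) (k : ℕ) : L2 Ω :=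
  (lam k ^ (-s) * coeff φ f k) • φ k

/-- The `k`-th term `λ_k^{-s} ln(λ_k) f_k φ_k`. -/
def stateTerm₁ {n : ℕ} {Ω : Set (EuclideanSpace ℝ (Fin n))} (lam : ℕ → ℝ)
    (φ : HilbertBasis ℕ ℝ (L2 Ω)) (f : L2 Ω) (s : ℝ) (k : ℕ) : L2 Ω :=
  (lam k ^ (-s) * Real.log (lam k) * coeff φ f k) • φ k

/-- The `k`-th term `λ_k^{-s} ln²(λ_k) f_k φ_k`. -/
def stateTerm₂ {n : ℕ} {Ω : Set (EuclideanSpace ℝ (Fin n))} (lam : ℕ → ℝ)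
    (φ : HilbertBasis ℕ ℝ (L2 Ω)) (f : L2 Ω) (s : ℝ) (k : ℕ) : L2 Ω :=
  (lam k ^ (-s) * Real.log (lam k) ^ 2 * coeff φ f k) • φ k

/-- The control-to-state map `𝒮(s) = ∑_k λ_k^{-s} f_k φ_k`, series in `L²(Ω)`. Only the values
at `s ∈ (0,1)` matter. -/
def controlToState {n : ℕ} {Ω : Set (EuclideanSpace ℝ (Fin n))} (lam : ℕ → ℝ)
    (φ : HilbertBasis ℕ ℝ (L2 Ω)) (f : L2 Ω) (s : ℝ) : L2 Ω :=
  ∑' k, stateTerm lam φ f s k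

/-- `D_s u(s) = - ∑_k λ_k^{-s} ln(λ_k) f_k φ_k`. -/
def Dsu {n : ℕ} {Ω : Set (EuclideanSpace ℝ (Fin n))} (lam : ℕ → ℝ)
    (φ : HilbertBasis ℕ ℝ (L2 Ω)) (f : L2 Ω) (s : ℝ) : L2 Ω :=
  - ∑' k, stateTerm₁ lam φ f s k

/-- `D_s² u(s) = ∑_k λ_k^{-s} ln²(λ_k) f_k φ_k`. -/
def Dssu {n : ℕ} {Ω : Set (EuclideanSpace ℝ (Fin n))} (lam : ℕ → ℝ)
    (φ : HilbertBasis ℕ ℝ (L2 Ω)) (f : L2 Ω) (s : ℝ) : L2 Ω :=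
  ∑' k, stateTerm₂ lam φ f s k

end FracIdent

end

/-!
The whole dependence on `Ω` is a lower bound for the Dirichlet eigenvalues. If `‖x‖ ≤ R` on `Ω`,
integrating `ψ² = ψ² ∂ₑ⟨e, x⟩` by parts for a unit vector `e` gives the Poincaré inequality
`‖ψ‖ ≤ 2R ‖∇ψ‖` for test functions (`IsTestFunction.integral_sq_le`), hence on `H₀¹(Ω)` by
approximation (`IsH10.norm_le`). Testing the eigenvalue equation with `φ_k` itself yields
`1 ≤ (2R)² λ_k` (`IsDirichletEigensystem.one_le_mul`).

Put `a_k = -ln λ_k`; these numbers have an upper bound `A` depending on `R` only, and the state is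
`∑ e^{a_k s} f_k φ_k`. Its formal `m`-th derivative has the weights `a_k^m e^{a_k s}`, which are at
most `m!/s^m + A^m e^{As}`: for `a_k ≤ 0` because `x^m e^{-x} ≤ m!` with `x = -a_k s`, and for
`0 ≤ a_k ≤ A` by monotonicity (`abs_pow_mul_exp_le`). A diagonal operator in an orthonormal basis
is bounded by the supremum of its weights (`summable_diagonal_and_norm_tsum_le`), so the weight
bound gives convergence of all series and the norm estimates. The series need not converge
absolutely, so termwise differentiation rests on a second-order Taylor estimate of the weights
that is uniform in `k` (`abs_taylor_exp_weight_le`, `hasDerivAt_expFamily`). In one real variable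
iterated Fréchet derivatives are isometric to iterated derivatives, which gives the theorem.
-/

open MeasureTheory Filter Topology
open scoped ENNReal ContDiff

namespace FracIdent

/-! ### Poincaré inequality and the lower bound on the eigenvalues -/

section Poincare

variable {n : ℕ} {Ω : Set (EuclideanSpace ℝ (Fin n))} {ψ : EuclideanSpace ℝ (Fin n) → ℝ}

theorem norm_gradient_eq (x : EuclideanSpace ℝ (Fin n)) :
    ‖gradient ψ x‖ = ‖fderiv ℝ ψ x‖ := by
  simp [gradient]

theorem IsTestFunction.continuous_gradient (hψ : IsTestFunction Ω ψ) :
    Continuous (gradient ψ) :=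
  (InnerProductSpace.toDual ℝ _).symm.continuous.comp
    (hψ.smooth.continuous_fderiv (by simp))

theorem IsTestFunction.hasCompactSupport_gradient (hψ : IsTestFunction Ω ψ) :
    HasCompactSupport (gradient ψ) := by
  have := (hψ.compact.fderiv (𝕜 := ℝ)).comp_left
    (g := (InnerProductSpace.toDual ℝ (EuclideanSpace ℝ (Fin n))).symm) (map_zero _)
  exact this

/-- Integration by parts of `ψ² = ψ² ∂ₑ l`, where the linear form `l` satisfies `∂ₑ l = 1`. -/
theorem integral_sq_eq_of_apply_eq_one {E : Type*} [NormedAddCommGroup E] [NormedSpace ℝ E]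
    [FiniteDimensional ℝ E] [MeasurableSpace E] [BorelSpace E] {μ : Measure E}
    [μ.IsAddHaarMeasure] {ψ : E → ℝ} (hψ : ContDiff ℝ 1 ψ) (hc : HasCompactSupport ψ)
    {l : E →L[ℝ] ℝ} {e : E} (hle : l e = 1) :
    Integrable (fun x => l x * (2 * ψ x * fderiv ℝ ψ x e)) μ ∧
      ∫ x, ψ x ^ 2 ∂μ = -∫ x, l x * (2 * ψ x * fderiv ℝ ψ x e) ∂μ := by
  have hψd : Differentiable ℝ ψ := hψ.differentiable (by simp)
  have hψc : Continuous ψ := hψ.continuous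
  have hdc : Continuous fun x => fderiv ℝ ψ x e :=
    (hψ.continuous_fderiv (by simp)).clm_apply continuous_const
  have hlc : Continuous fun x => l x := l.continuous
  have hsq : ∀ x, fderiv ℝ (fun y => ψ y ^ 2) x e = 2 * ψ x * fderiv ℝ ψ x e := by
    intro x
    rw [((hψd x).hasFDerivAt.pow 2).fderiv]
    simp
  have hcs : HasCompactSupport fun x => ψ x ^ 2 :=
    hc.comp_left (g := fun t : ℝ => t ^ 2) (by simp)
  have hi2 : Integrable (fun x => ψ x ^ 2) μ := (hψc.pow 2).integrable_of_hasCompactSupport hcs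
  have hi3 : Integrable (fun x => l x * (2 * ψ x * fderiv ℝ ψ x e)) μ :=
    (hlc.mul ((continuous_const.mul hψc).mul hdc)).integrable_of_hasCompactSupport
      ((hc.mul_left (f := fun _ => (2 : ℝ))).mul_right).mul_left
  refine ⟨hi3, ?_⟩
  have hmain := integral_mul_fderiv_eq_neg_fderiv_mul_of_integrable
    (μ := μ) (f := fun x => l x) (g := fun x => ψ x ^ 2) (v := e)
    (by simpa [hle] using hi2) (by simpa only [hsq] using hi3)
    ((hlc.mul (hψc.pow 2)).integrable_of_hasCompactSupport hcs.mul_left)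
    (fun x _ => l.differentiableAt) (fun x _ => (hψd x).pow 2)
  simp only [hsq, ContinuousLinearMap.fderiv, hle, one_mul] at hmain
  rw [hmain, neg_neg]

/-- **Poincaré inequality** for test functions on a set of radius `R`: integrate by parts against
a coordinate function and absorb half of `∫ ψ²`. -/
theorem IsTestFunction.integral_sq_le (hn : 1 ≤ n) {R : ℝ} (hR : ∀ x ∈ Ω, ‖x‖ ≤ R)
    (hψ : IsTestFunction Ω ψ) :
    ∫ x, ψ x ^ 2 ≤ 4 * R ^ 2 * ∫ x, ‖gradient ψ x‖ ^ 2 := by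
  obtain ⟨e, he⟩ : ∃ e : EuclideanSpace ℝ (Fin n), ‖e‖ = 1 :=
    ⟨EuclideanSpace.single ⟨0, hn⟩ 1, by simp⟩
  obtain ⟨l, hle, hl⟩ : ∃ l : EuclideanSpace ℝ (Fin n) →L[ℝ] ℝ, l e = 1 ∧ ∀ x, |l x| ≤ ‖x‖ := by
    refine ⟨innerSL ℝ e, by simp [he], fun x => ?_⟩
    simpa [he] using norm_inner_le_norm (𝕜 := ℝ) e x
  have hcs : HasCompactSupport fun x => ψ x ^ 2 :=
    hψ.compact.comp_left (g := fun t : ℝ => t ^ 2) (by simp)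
  have hcg : HasCompactSupport fun x => ‖gradient ψ x‖ ^ 2 :=
    hψ.hasCompactSupport_gradient.norm.comp_left (g := fun t : ℝ => t ^ 2) (by simp)
  have hψc : Continuous fun x => ψ x ^ 2 := hψ.smooth.continuous.pow 2
  have hgc : Continuous fun x => ‖gradient ψ x‖ ^ 2 := hψ.continuous_gradient.norm.pow 2
  have hi2 : Integrable fun x => ψ x ^ 2 := hψc.integrable_of_hasCompactSupport hcs
  have hig : Integrable fun x => ‖gradient ψ x‖ ^ 2 := hgc.integrable_of_hasCompactSupport hcg
  obtain ⟨hi3, h1⟩ := integral_sq_eq_of_apply_eq_one (μ := volume)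
    (hψ.smooth.of_le (by simp)) hψ.compact hle
  -- pointwise Young inequality
  have h2 : ∀ x, -(l x * (2 * ψ x * fderiv ℝ ψ x e)) ≤
      1 / 2 * ψ x ^ 2 + 2 * R ^ 2 * ‖gradient ψ x‖ ^ 2 := by
    intro x
    by_cases hx : x ∈ Ω
    · have hlR : |l x| ≤ R := (hl x).trans (hR x hx)
      have hd : |fderiv ℝ ψ x e| ≤ ‖gradient ψ x‖ := by
        have := (fderiv ℝ ψ x).le_opNorm e
        rw [he, mul_one] at this
        rwa [norm_gradient_eq]
      have hp : (l x * fderiv ℝ ψ x e) ^ 2 ≤ R ^ 2 * ‖gradient ψ x‖ ^ 2 := by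
        rw [← sq_abs, abs_mul, mul_pow]
        gcongr
      nlinarith [sq_nonneg (ψ x + 2 * (l x * fderiv ℝ ψ x e))]
    · have : ψ x = 0 := image_eq_zero_of_notMem_tsupport fun h => hx (hψ.support_subset h)
      simp only [this]
      nlinarith [mul_nonneg (sq_nonneg R) (sq_nonneg ‖gradient ψ x‖)]
  have h4 := integral_mono hi3.neg ((hi2.const_mul (1 / 2)).add (hig.const_mul (2 * R ^ 2))) h2
  have h5 : ∫ x, (1 / 2 * ψ x ^ 2 + 2 * R ^ 2 * ‖gradient ψ x‖ ^ 2) =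
      1 / 2 * (∫ x, ψ x ^ 2) + 2 * R ^ 2 * ∫ x, ‖gradient ψ x‖ ^ 2 := by
    rw [integral_add (hi2.const_mul _) (hig.const_mul _), integral_const_mul, integral_const_mul]
  have h6 : ∫ x, -(l x * (2 * ψ x * fderiv ℝ ψ x e)) = ∫ x, ψ x ^ 2 := by
    rw [integral_neg, h1]
  have h7 := h6.symm.trans_le (h4.trans_eq h5)
  linarith

theorem eLpNorm_restrict_of_tsupport_subset {F : Type*} [NormedAddCommGroup F]
    {g : EuclideanSpace ℝ (Fin n) → F} (hg : tsupport g ⊆ Ω) (hΩ : MeasurableSet Ω) :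
    eLpNorm g 2 (volume.restrict Ω) = eLpNorm g 2 volume := by
  rw [← eLpNorm_indicator_eq_eLpNorm_restrict hΩ,
    Set.indicator_eq_self.2 ((subset_tsupport g).trans hg)]

theorem IsTestFunction.tsupport_gradient_subset (hψ : IsTestFunction Ω ψ) :
    tsupport (gradient ψ) ⊆ Ω := by
  refine subset_trans (closure_mono ?_) ((tsupport_fderiv_subset ℝ).trans hψ.support_subset)
  intro x hx
  contrapose! hx
  simp only [Function.mem_support, not_not] at hx ⊢
  simp [gradient, hx]

theorem eLpNorm_two_eq_ofReal_sqrt {F : Type*} [NormedAddCommGroup F]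
    {g : EuclideanSpace ℝ (Fin n) → F} (hg : Continuous g) (hgc : HasCompactSupport g) :
    eLpNorm g 2 volume = ENNReal.ofReal √(∫ x, ‖g x‖ ^ 2) := by
  rw [(hg.memLp_of_hasCompactSupport hgc).eLpNorm_eq_integral_rpow_norm two_ne_zero
    ENNReal.ofNat_ne_top]
  simp [Real.sqrt_eq_rpow]

theorem IsTestFunction.eLpNorm_le (hn : 1 ≤ n) (hΩ : MeasurableSet Ω) {R : ℝ} (hR0 : 0 ≤ R)
    (hR : ∀ x ∈ Ω, ‖x‖ ≤ R) (hψ : IsTestFunction Ω ψ) :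
    eLpNorm ψ 2 (volume.restrict Ω) ≤
      ENNReal.ofReal (2 * R) * eLpNorm (gradient ψ) 2 (volume.restrict Ω) := by
  rw [eLpNorm_restrict_of_tsupport_subset hψ.support_subset hΩ,
    eLpNorm_restrict_of_tsupport_subset hψ.tsupport_gradient_subset hΩ,
    eLpNorm_two_eq_ofReal_sqrt hψ.smooth.continuous hψ.compact,
    eLpNorm_two_eq_ofReal_sqrt hψ.continuous_gradient hψ.hasCompactSupport_gradient,
    ← ENNReal.ofReal_mul (by positivity)]
  apply ENNReal.ofReal_le_ofReal
  have h := hψ.integral_sq_le hn hR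
  rw [← Real.sqrt_sq (show 0 ≤ 2 * R by positivity), ← Real.sqrt_mul (sq_nonneg _)]
  apply Real.sqrt_le_sqrt
  simp only [Real.norm_eq_abs, sq_abs]
  linarith

/-- **Poincaré inequality** in `H₀¹(Ω)`, by passing to the limit in the approximating test
functions. -/
theorem IsH10.norm_le (hn : 1 ≤ n) (hΩ : MeasurableSet Ω) {R : ℝ} (hR0 : 0 ≤ R)
    (hR : ∀ x ∈ Ω, ‖x‖ ≤ R) {u : L2 Ω} {G : L2Field Ω} (h : IsH10 Ω u G) :
    ‖u‖ ≤ 2 * R * ‖G‖ := by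
  obtain ⟨ψ, hψ, hu, hG⟩ := h.approx
  have key : ∀ j, eLpNorm u 2 (volume.restrict Ω) ≤
      eLpNorm (fun x => ψ j x - u x) 2 (volume.restrict Ω) + ENNReal.ofReal (2 * R) *
        (eLpNorm (fun x => gradient (ψ j) x - G x) 2 (volume.restrict Ω) +
          eLpNorm G 2 (volume.restrict Ω)) := by
    intro j
    have mψ : AEStronglyMeasurable (ψ j) (volume.restrict Ω) :=
      (hψ j).smooth.continuous.aestronglyMeasurable
    have mg : AEStronglyMeasurable (gradient (ψ j)) (volume.restrict Ω) :=
      (hψ j).continuous_gradient.aestronglyMeasurable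
    have mu := Lp.aestronglyMeasurable u
    have mG := Lp.aestronglyMeasurable G
    have e1 : eLpNorm u 2 (volume.restrict Ω) ≤
        eLpNorm (fun x => ψ j x - u x) 2 (volume.restrict Ω) +
          eLpNorm (ψ j) 2 (volume.restrict Ω) := by
      have := eLpNorm_sub_le (p := 2) mψ (mψ.sub mu) (by norm_num)
      rw [sub_sub_cancel, add_comm] at this
      exact this
    have e2 : eLpNorm (gradient (ψ j)) 2 (volume.restrict Ω) ≤
        eLpNorm (fun x => gradient (ψ j) x - G x) 2 (volume.restrict Ω) +
          eLpNorm G 2 (volume.restrict Ω) := by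
      have := eLpNorm_add_le (p := 2) (mg.sub mG) mG (by norm_num)
      rw [sub_add_cancel] at this
      exact this
    refine e1.trans (add_le_add le_rfl (((hψ j).eLpNorm_le hn hΩ hR0 hR).trans ?_))
    gcongr
  have hlim := hu.add (ENNReal.Tendsto.const_mul (a := ENNReal.ofReal (2 * R))
    (hG.add_const (eLpNorm G 2 (volume.restrict Ω))) (Or.inr ENNReal.ofReal_ne_top))
  have := ge_of_tendsto' hlim key
  rw [zero_add, zero_add] at this
  rw [Lp.norm_def, Lp.norm_def, ← ENNReal.toReal_ofReal (show 0 ≤ 2 * R by positivity),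
    ← ENNReal.toReal_mul]
  exact ENNReal.toReal_mono (ENNReal.mul_ne_top ENNReal.ofReal_ne_top (Lp.eLpNorm_ne_top G)) this

/-- The Dirichlet eigenvalues are bounded below by a constant that depends on `Ω` only: test the
equation with the eigenfunction itself and use the Poincaré inequality. -/
theorem IsDirichletEigensystem.one_le_mul (hn : 1 ≤ n) (hΩ : MeasurableSet Ω) {R : ℝ}
    (hR0 : 0 ≤ R) (hR : ∀ x ∈ Ω, ‖x‖ ≤ R) {lam : ℕ → ℝ} {φ : HilbertBasis ℕ ℝ (L2 Ω)}
    (h : IsDirichletEigensystem Ω lam φ) (k : ℕ) : 1 ≤ (2 * R) ^ 2 * lam k := by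
  obtain ⟨G, hG, hv⟩ := h.eigen k
  have h1 := hv _ _ hG
  have hφ : ‖φ k‖ = 1 := φ.orthonormal.1 k
  rw [real_inner_self_eq_norm_sq, real_inner_self_eq_norm_sq, hφ] at h1
  have h2 := hG.norm_le hn hΩ hR0 hR
  rw [hφ] at h2
  nlinarith [norm_nonneg G]

end Poincare

/-! ### Diagonal operators in a Hilbert basis -/

section Multiplier

variable {H : Type*} [NormedAddCommGroup H] [InnerProductSpace ℝ H]

/-- A bounded sequence `w` defines a bounded diagonal operator `f ↦ ∑ w_k ⟨f, φ_k⟩ φ_k` in a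
Hilbert basis. -/
theorem summable_diagonal_and_norm_tsum_le (φ : HilbertBasis ℕ ℝ H) (f : H) {w : ℕ → ℝ} {B : ℝ}
    (hw : ∀ k, |w k| ≤ B) :
    Summable (fun k => (w k * inner ℝ f (φ k)) • φ k) ∧
      ‖∑' k, (w k * inner ℝ f (φ k)) • φ k‖ ≤ B * ‖f‖ := by
  have hB : 0 ≤ B := (abs_nonneg _).trans (hw 0)
  have hle : ∀ k, ‖w k * inner ℝ f (φ k)‖ ≤ ‖(B • φ.repr f) k‖ := by
    intro k
    rw [lp.coeFn_smul, Pi.smul_apply, φ.repr_apply_apply, real_inner_comm, norm_mul, norm_smul,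
      Real.norm_eq_abs, Real.norm_eq_abs B, abs_of_nonneg hB]
    exact mul_le_mul_of_nonneg_right (hw k) (norm_nonneg _)
  let g : lp (fun _ : ℕ => ℝ) 2 :=
    ⟨fun k => w k * inner ℝ f (φ k), (lp.memℓp (B • φ.repr f)).mono' hle⟩
  have hs : HasSum (fun k => (w k * inner ℝ f (φ k)) • φ k) (φ.repr.symm g) :=
    φ.hasSum_repr_symm g
  refine ⟨hs.summable, ?_⟩
  rw [hs.tsum_eq, LinearIsometryEquiv.norm_map]
  calc ‖g‖ ≤ ‖B • φ.repr f‖ := lp.norm_mono two_ne_zero hle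
    _ = B * ‖f‖ := by rw [norm_smul, LinearIsometryEquiv.norm_map, Real.norm_of_nonneg hB]

end Multiplier

/-! ### Uniform estimates for the exponential weights -/

section Weights

/-- An upper bound for `|a ^ m * exp (a * s)|` over all `a ≤ A`. -/
noncomputable def expWeightBound (A : ℝ) (m : ℕ) (s : ℝ) : ℝ :=
  m.factorial / s ^ m + A ^ m * Real.exp (A * s)

/-- For `a ≤ 0` the factor `exp (a * s)` beats `|a| ^ m` at the cost of `m! / s ^ m`; for
`0 ≤ a ≤ A` the weight is monotone in `a`. -/
theorem abs_pow_mul_exp_le {A a s : ℝ} (hA : 0 ≤ A) (ha : a ≤ A) (hs : 0 < s) (m : ℕ) :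
    |a| ^ m * Real.exp (a * s) ≤ expWeightBound A m s := by
  unfold expWeightBound
  rcases le_total 0 a with h | h
  · have : |a| ^ m * Real.exp (a * s) ≤ A ^ m * Real.exp (A * s) := by
      rw [abs_of_nonneg h]
      gcongr
    have : (0 : ℝ) ≤ m.factorial / s ^ m := by positivity
    linarith
  · have h1 := Real.pow_div_factorial_le_exp (-a * s) (mul_nonneg (neg_nonneg.2 h) hs.le) m
    have h2 : |a| ^ m * Real.exp (a * s) ≤ m.factorial / s ^ m := by
      rw [abs_of_nonpos h, le_div_iff₀ (by positivity)]
      rw [div_le_iff₀ (by positivity), mul_pow, neg_mul, Real.exp_neg] at h1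
      have := mul_le_mul_of_nonneg_right h1 (Real.exp_pos (a * s)).le
      field_simp at this
      linarith
    have : 0 ≤ A ^ m * Real.exp (A * s) := by positivity
    linarith

theorem abs_exp_sub_one_sub_id_le_sq_mul_exp_abs (x : ℝ) :
    |Real.exp x - 1 - x| ≤ x ^ 2 * Real.exp |x| := by
  have := Complex.norm_exp_sub_sum_le_norm_mul_exp (x : ℂ) 2
  rw [Finset.sum_range_succ, Finset.sum_range_one] at this
  simp only [pow_zero, pow_one, Nat.factorial, Nat.cast_one, div_one, Complex.norm_real,
    Real.norm_eq_abs, sq_abs, mul_one, Nat.succ_eq_add_one, zero_add] at this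
  rw [sub_sub, ← Real.norm_eq_abs, ← Complex.norm_real]
  exact_mod_cast this

/-- Second-order Taylor estimate in the exponent, uniform over all `a ≤ A`. -/
theorem abs_taylor_exp_weight_le {A a s t : ℝ} (hA : 0 ≤ A) (ha : a ≤ A) (hs : 0 < s)
    (ht : |t - s| ≤ s / 2) (m : ℕ) :
    |a ^ m * Real.exp (a * t) - a ^ m * Real.exp (a * s)
        - (t - s) * (a ^ (m + 1) * Real.exp (a * s))| ≤
      (expWeightBound A (m + 2) (s / 2) + expWeightBound A (m + 2) (3 * s / 2))
        * (t - s) ^ 2 := by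
  have e0 : a ^ m * Real.exp (a * t) - a ^ m * Real.exp (a * s)
        - (t - s) * (a ^ (m + 1) * Real.exp (a * s)) =
      a ^ m * Real.exp (a * s) * (Real.exp (a * (t - s)) - 1 - a * (t - s)) := by
    rw [show a * t = a * s + a * (t - s) by ring, Real.exp_add]; ring
  -- the remainder factor moves the exponent at most to `s / 2` if `a ≤ 0`, to `3 * s / 2` if `0 ≤ a`
  have e1 : Real.exp (a * s) * Real.exp |a * (t - s)| ≤
      Real.exp (a * (s / 2)) + Real.exp (a * (3 * s / 2)) := by
    rw [← Real.exp_add, abs_mul]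
    rcases le_total 0 a with h | h
    · have : a * s + |a| * |t - s| ≤ a * (3 * s / 2) := by
        rw [abs_of_nonneg h]
        nlinarith [mul_le_mul_of_nonneg_left ht h]
      linarith [Real.exp_le_exp.2 this, Real.exp_pos (a * (s / 2))]
    · have : a * s + |a| * |t - s| ≤ a * (s / 2) := by
        rw [abs_of_nonpos h]
        nlinarith [mul_le_mul_of_nonneg_left ht (neg_nonneg.2 h)]
      linarith [Real.exp_le_exp.2 this, Real.exp_pos (a * (3 * s / 2))]
  calc _ = |a| ^ m * Real.exp (a * s) * |Real.exp (a * (t - s)) - 1 - a * (t - s)| := by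
        rw [e0, abs_mul, abs_mul, abs_pow, Real.abs_exp]
    _ ≤ |a| ^ m * Real.exp (a * s) * ((a * (t - s)) ^ 2 * Real.exp |a * (t - s)|) := by
        gcongr
        exact abs_exp_sub_one_sub_id_le_sq_mul_exp_abs _
    _ = |a| ^ (m + 2) * (Real.exp (a * s) * Real.exp |a * (t - s)|) * (t - s) ^ 2 := by
        rw [pow_add, sq_abs]; ring
    _ ≤ |a| ^ (m + 2) * (Real.exp (a * (s / 2)) + Real.exp (a * (3 * s / 2)))
          * (t - s) ^ 2 := by gcongr
    _ ≤ _ := by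
        rw [mul_add]
        gcongr
        · exact abs_pow_mul_exp_le hA ha (by positivity) _
        · exact abs_pow_mul_exp_le hA ha (by positivity) _

end Weights

/-! ### Exponential families of diagonal operators -/

section Family

variable {H : Type*} [NormedAddCommGroup H] [InnerProductSpace ℝ H]

/-- The formal `m`-th derivative `∑_k a_k^m e^{a_k s} ⟨f, φ_k⟩ φ_k` of the family
`s ↦ ∑_k e^{a_k s} ⟨f, φ_k⟩ φ_k`. -/
noncomputable def expFamily (φ : HilbertBasis ℕ ℝ H) (a : ℕ → ℝ) (f : H) (m : ℕ) (s : ℝ) : H :=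
  ∑' k, (a k ^ m * Real.exp (a k * s) * inner ℝ f (φ k)) • φ k

variable (φ : HilbertBasis ℕ ℝ H) {a : ℕ → ℝ} (f : H) {A : ℝ}

theorem abs_exp_weight_le (hA : 0 ≤ A) (ha : ∀ k, a k ≤ A) {s : ℝ} (hs : 0 < s) (m k : ℕ) :
    |a k ^ m * Real.exp (a k * s)| ≤ expWeightBound A m s := by
  rw [abs_mul, abs_pow, Real.abs_exp]
  exact abs_pow_mul_exp_le hA (ha k) hs m

theorem summable_expFamily (hA : 0 ≤ A) (ha : ∀ k, a k ≤ A) {s : ℝ} (hs : 0 < s) (m : ℕ) :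
    Summable fun k => (a k ^ m * Real.exp (a k * s) * inner ℝ f (φ k)) • φ k :=
  (summable_diagonal_and_norm_tsum_le φ f (abs_exp_weight_le hA ha hs m)).1

theorem norm_expFamily_le (hA : 0 ≤ A) (ha : ∀ k, a k ≤ A) {s : ℝ} (hs : 0 < s) (m : ℕ) :
    ‖expFamily φ a f m s‖ ≤ expWeightBound A m s * ‖f‖ :=
  (summable_diagonal_and_norm_tsum_le φ f (abs_exp_weight_le hA ha hs m)).2

/-- Termwise differentiation: the scalar Taylor estimate is uniform in `k`, and diagonal operators
are bounded by the supremum of their entries. -/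
theorem hasDerivAt_expFamily (hA : 0 ≤ A) (ha : ∀ k, a k ≤ A) {s : ℝ} (hs : 0 < s) (m : ℕ) :
    HasDerivAt (expFamily φ a f m) (expFamily φ a f (m + 1) s) s := by
  set M := expWeightBound A (m + 2) (s / 2) + expWeightBound A (m + 2) (3 * s / 2)
  rw [hasDerivAt_iff_isLittleO]
  have hev : ∀ᶠ t in 𝓝 s, |t - s| < s / 2 :=
    Metric.eventually_nhds_iff.2 ⟨s / 2, by positivity, fun t ht => by rwa [Real.dist_eq] at ht⟩
  refine Asymptotics.IsBigO.trans_isLittleO (g := fun t => (t - s) ^ 2)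
    (Asymptotics.IsBigO.of_bound (M * ‖f‖) ?_) ?_
  · filter_upwards [hev] with t ht
    have ht0 : 0 < t := by linarith [(abs_lt.1 ht).1]
    have hsum := ((summable_expFamily φ f hA ha ht0 m).hasSum.sub
      (summable_expFamily φ f hA ha hs m).hasSum).sub
      ((summable_expFamily φ f hA ha hs (m + 1)).hasSum.const_smul (t - s))
    have hterm := summable_diagonal_and_norm_tsum_le φ f (fun k =>
      (abs_taylor_exp_weight_le hA (ha k) hs ht.le m))
    have heq : expFamily φ a f m t - expFamily φ a f m s - (t - s) • expFamily φ a f (m + 1) s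
        = ∑' k, ((a k ^ m * Real.exp (a k * t) - a k ^ m * Real.exp (a k * s)
          - (t - s) * (a k ^ (m + 1) * Real.exp (a k * s))) * inner ℝ f (φ k)) • φ k := by
      rw [expFamily, expFamily, expFamily, ← hsum.tsum_eq]
      refine tsum_congr fun k => ?_
      rw [smul_smul, ← sub_smul, ← sub_smul]
      congr 1
      ring
    rw [heq, Real.norm_of_nonneg (sq_nonneg _)]
    refine hterm.2.trans_eq (by ring)
  · simpa using Asymptotics.isLittleO_pow_sub_sub s one_lt_two

/-- A function that agrees with the family for positive parameters has the formal derivatives as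
its iterated derivatives there. -/
theorem iteratedDeriv_eq_expFamily (hA : 0 ≤ A) (ha : ∀ k, a k ≤ A) {S : ℝ → H}
    (hS : ∀ s, 0 < s → S s = expFamily φ a f 0 s) (m : ℕ) :
    ∀ s, 0 < s → iteratedDeriv m S s = expFamily φ a f m s := by
  induction m with
  | zero => simpa using hS
  | succ m ih =>
    intro s hs
    rw [iteratedDeriv_succ, Filter.EventuallyEq.deriv_eq (f := expFamily φ a f m)]
    · exact (hasDerivAt_expFamily φ f hA ha hs m).deriv
    · filter_upwards [lt_mem_nhds hs] with t ht using ih t ht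

theorem differentiableAt_iteratedFDeriv_of_eq_expFamily (hA : 0 ≤ A) (ha : ∀ k, a k ≤ A)
    {S : ℝ → H} (hS : ∀ s, 0 < s → S s = expFamily φ a f 0 s) (m : ℕ) {s : ℝ} (hs : 0 < s) :
    DifferentiableAt ℝ (iteratedFDeriv ℝ m S) s := by
  rw [iteratedFDeriv_eq_equiv_comp]
  refine (LinearIsometryEquiv.differentiable _).differentiableAt.comp s ?_
  refine (hasDerivAt_expFamily φ f hA ha hs m).differentiableAt.congr_of_eventuallyEq ?_
  filter_upwards [lt_mem_nhds hs] with t ht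
    using iteratedDeriv_eq_expFamily φ f hA ha hS m t ht

end Family

/-! ### The control-to-state map -/

section State

/-- For `m ≤ 3` and `s ≤ 1` both parts of the weight bound are absorbed into one multiple of
`s ^ (-m)`, with a constant depending on `A` only; the `6` is `3!`. -/
theorem expWeightBound_le {A s : ℝ} (hA : 1 ≤ A) (hs : 0 < s) (hs1 : s ≤ 1) {m : ℕ} (hm : m ≤ 3) :
    expWeightBound A m s ≤ (6 + A ^ 3 * Real.exp A) / s ^ m := by
  unfold expWeightBound
  have h1 : ((m.factorial : ℕ) : ℝ) ≤ 6 := by exact_mod_cast Nat.factorial_le hm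
  have h2 : A ^ m * Real.exp (A * s) ≤ A ^ 3 * Real.exp A := by
    gcongr
    exact mul_le_of_le_one_right (by positivity) hs1
  have h3 : A ^ 3 * Real.exp A ≤ A ^ 3 * Real.exp A / s ^ m :=
    le_div_self (by positivity) (by positivity) (pow_le_one₀ hs.le hs1)
  rw [add_div]
  gcongr
  exact h2.trans h3

variable {n : ℕ} {Ω : Set (EuclideanSpace ℝ (Fin n))} {lam : ℕ → ℝ}
  (φ : HilbertBasis ℕ ℝ (L2 Ω)) (f : L2 Ω)

theorem stateTerm_eq (hlam : ∀ k, 0 < lam k) (s : ℝ) : stateTerm lam φ f s =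
    fun k => ((-Real.log (lam k)) ^ 0 * Real.exp (-Real.log (lam k) * s) * inner ℝ f (φ k)) •
      φ k := by
  ext1 k
  rw [stateTerm, coeff, Real.rpow_def_of_pos (hlam k)]
  simp

theorem stateTerm₁_eq (hlam : ∀ k, 0 < lam k) (s : ℝ) : stateTerm₁ lam φ f s =
    fun k => -(((-Real.log (lam k)) ^ 1 * Real.exp (-Real.log (lam k) * s) *
      inner ℝ f (φ k)) • φ k) := by
  ext1 k
  rw [stateTerm₁, coeff, Real.rpow_def_of_pos (hlam k), ← neg_smul, mul_neg, ← neg_mul]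
  congr 1
  ring

theorem stateTerm₂_eq (hlam : ∀ k, 0 < lam k) (s : ℝ) : stateTerm₂ lam φ f s =
    fun k => ((-Real.log (lam k)) ^ 2 * Real.exp (-Real.log (lam k) * s) * inner ℝ f (φ k)) •
      φ k := by
  ext1 k
  rw [stateTerm₂, coeff, Real.rpow_def_of_pos (hlam k), mul_neg, ← neg_mul]
  congr 1
  ring

end State

end FracIdent

theorem mainTheorem1 {n : ℕ} (hn : 1 ≤ n) (Ω : Set (EuclideanSpace ℝ (Fin n)))
    (hne : Ω.Nonempty) (hopen : IsOpen Ω) (hbdd : Bornology.IsBounded Ω) :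
    -- the constant depends on `Ω` only
    ∃ C : ℝ, ∀ (lam : ℕ → ℝ) (φ : HilbertBasis ℕ ℝ (FracIdent.L2 Ω)),
      FracIdent.IsDirichletEigensystem Ω lam φ → ∀ f : FracIdent.L2 Ω,
      -- the series converge in `L²(Ω)`
      (∀ s ∈ Set.Ioo (0 : ℝ) 1,
        Summable (FracIdent.stateTerm lam φ f s) ∧
        Summable (FracIdent.stateTerm₁ lam φ f s) ∧
        Summable (FracIdent.stateTerm₂ lam φ f s)) ∧
      -- uniform boundedness
      (∀ s ∈ Set.Ioo (0 : ℝ) 1, ‖FracIdent.controlToState lam φ f s‖ ≤ C * ‖f‖) ∧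
      -- three times Fréchet differentiable
      (∀ m < 3, ∀ s ∈ Set.Ioo (0 : ℝ) 1,
        DifferentiableAt ℝ (iteratedFDeriv ℝ m (FracIdent.controlToState lam φ f)) s) ∧
      -- the first and second derivatives
      (∀ s ∈ Set.Ioo (0 : ℝ) 1, ∀ h₁ h₂ : ℝ,
        iteratedFDeriv ℝ 1 (FracIdent.controlToState lam φ f) s ![h₁] =
          h₁ • FracIdent.Dsu lam φ f s ∧
        iteratedFDeriv ℝ 2 (FracIdent.controlToState lam φ f) s ![h₁, h₂] =
          (h₁ * h₂) • FracIdent.Dssu lam φ f s) ∧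
      -- bounds on the derivatives
      (∀ m : ℕ, 1 ≤ m → m ≤ 3 → ∀ s ∈ Set.Ioo (0 : ℝ) 1,
        ‖iteratedFDeriv ℝ m (FracIdent.controlToState lam φ f) s‖ ≤ C * ‖f‖ / s ^ m) := by
  obtain ⟨R, hR0, hR⟩ := hbdd.exists_pos_norm_le
  -- since `1 ≤ (2 * R) ^ 2 * λ_k`, this is an upper bound for all `-log λ_k`; the maximum with `1`
  -- makes `A ^ m ≤ A ^ 3` for `m ≤ 3`
  set A : ℝ := max 1 (Real.log ((2 * R) ^ 2))
  have hA1 : 1 ≤ A := le_max_left _ _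
  have hA : 0 ≤ A := zero_le_one.trans hA1
  refine ⟨6 + A ^ 3 * Real.exp A, fun lam φ hsys f => ?_⟩
  have hpos := hsys.pos
  have ha : ∀ k, -Real.log (lam k) ≤ A := by
    intro k
    have h := Real.log_nonneg (hsys.one_le_mul hn hopen.measurableSet hR0.le hR k)
    rw [Real.log_mul (by positivity) (hpos k).ne'] at h
    exact le_max_of_le_right (by linarith)
  set a : ℕ → ℝ := fun k => -Real.log (lam k)
  have hS : ∀ s, 0 < s →
      FracIdent.controlToState lam φ f s = FracIdent.expFamily φ a f 0 s := by
    intro s _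
    rw [FracIdent.controlToState, FracIdent.stateTerm_eq φ f hpos, FracIdent.expFamily]
  have hiter := FracIdent.iteratedDeriv_eq_expFamily φ f hA ha hS
  have hnorm : ∀ m ≤ 3, ∀ s ∈ Set.Ioo (0 : ℝ) 1, ‖FracIdent.expFamily φ a f m s‖ ≤
      (6 + A ^ 3 * Real.exp A) * ‖f‖ / s ^ m := by
    intro m hm s hs
    refine (FracIdent.norm_expFamily_le φ f hA ha hs.1 m).trans ?_
    rw [mul_div_right_comm]
    gcongr
    exact FracIdent.expWeightBound_le hA1 hs.1 hs.2.le hm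
  refine ⟨fun s hs => ⟨?_, ?_, ?_⟩, fun s hs => ?_, fun m _ s hs => ?_,
    fun s hs h₁ h₂ => ⟨?_, ?_⟩, fun m _ hm s hs => ?_⟩
  · rw [FracIdent.stateTerm_eq φ f hpos]
    exact FracIdent.summable_expFamily φ f hA ha hs.1 0
  · rw [FracIdent.stateTerm₁_eq φ f hpos]
    exact (FracIdent.summable_expFamily φ f hA ha hs.1 1).neg
  · rw [FracIdent.stateTerm₂_eq φ f hpos]
    exact FracIdent.summable_expFamily φ f hA ha hs.1 2
  · rw [hS s hs.1]
    simpa using hnorm 0 (by norm_num) s hs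
  · exact FracIdent.differentiableAt_iteratedFDeriv_of_eq_expFamily φ f hA ha hS m hs.1
  · rw [iteratedFDeriv_apply_eq_iteratedDeriv_mul_prod, hiter 1 s hs.1, FracIdent.Dsu,
      FracIdent.stateTerm₁_eq φ f hpos, tsum_neg, neg_neg, FracIdent.expFamily]
    simp
  · rw [iteratedFDeriv_apply_eq_iteratedDeriv_mul_prod, hiter 2 s hs.1, FracIdent.Dssu,
      FracIdent.stateTerm₂_eq φ f hpos, FracIdent.expFamily]
    simp
  · rw [norm_iteratedFDeriv_eq_norm_iteratedDeriv, hiter m s hs.1]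
    exact hnorm m hm s hs
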